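/- Let $n\ge 1$ and let $\Omega\subset\mathbb R^{2n}$ be a bounded open set (for instance a bounded domain). Let $H\in L^\infty(\Omega)$ be a real function and let $\vec F=(F_1,\dots,F_{2n})\in W^{1,2}(\Omega)$ be a vector field on $\Omega$. For a vector field $\vec G=(g_1,\dots,g_{2n})$ put $\vec G^{*}=(g_2,-g_1,g_4,-g_3,\dots,g_{2n},-g_{2n-1})$, and suppose that the weak divergence of $\vec F^{*}$ satisfies $\operatorname{div}\vec F^{*}>0$ a.e. in $\Omega$. For $u\in W^{1,1}(\Omega)$ let $$\mathcal F(u)=\int_\Omega\bigl(|\nabla u+\vec F|+Hu\bigr)\,dx ,$$ and call $u\in W^{1,1}(\Omega)$ a minimizer for $\mathcal F$ if $\mathcal F(u)\le\mathcal F(u+\varphi)$ for every $\varphi\in W^{1,1}_0(\Omega)$, where $W^{1,p}_0(\Omega)$ denotes the closure of $C_c^\infty(\Omega)$ in $W^{1,p}(\Omega)$. If $u,v\in W^{1,2}(\Omega)$ are two minimizers for $\mathcal F$ such that $u-v\in W^{1,2}_0(\Omega)$, then $u=v$ a.e. in $\Omega$. -/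

import Mathlib

open MeasureTheory Filter Topology
open scoped ENNReal ContDiff

noncomputable section

namespace HeisenbergMin

/-- The standard basis vector `e_i` of `ℝ^m`. -/
def stdVec {m : ℕ} (i : Fin m) : EuclideanSpace ℝ (Fin m) :=
  EuclideanSpace.single i (1 : ℝ)

/-- Test functions on `Ω`: smooth with compact support contained in `Ω`. -/
structure IsTest {m : ℕ} (Ω : Set (EuclideanSpace ℝ (Fin m)))
    (φ : EuclideanSpace ℝ (Fin m) → ℝ) : Prop where
  smooth : ContDiff ℝ ∞ φ
  compact : HasCompactSupport φ
  support : tsupport φ ⊆ Ω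

/-- `g` is a weak `i`-th partial derivative of `f` on `Ω`: both are locally integrable on `Ω`, and
`∫_Ω f ∂_i φ = - ∫_Ω g φ` for every test function `φ`. -/
structure HasWeakPartial {m : ℕ} (Ω : Set (EuclideanSpace ℝ (Fin m))) (i : Fin m)
    (f g : EuclideanSpace ℝ (Fin m) → ℝ) : Prop where
  locInt : LocallyIntegrableOn f Ω volume
  locInt_deriv : LocallyIntegrableOn g Ω volume
  integral_eq : ∀ φ : EuclideanSpace ℝ (Fin m) → ℝ, IsTest Ω φ →
    ∫ x in Ω, f x * fderiv ℝ φ x (stdVec i) = - ∫ x in Ω, g x * φ x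

open Classical in
/-- The weak `i`-th partial derivative of `f` on `Ω`, unique up to a null set where it exists
(and `0` if there is none). -/
def weakPartial {m : ℕ} (Ω : Set (EuclideanSpace ℝ (Fin m))) (i : Fin m)
    (f : EuclideanSpace ℝ (Fin m) → ℝ) : EuclideanSpace ℝ (Fin m) → ℝ :=
  if h : ∃ g, HasWeakPartial Ω i f g then h.choose else 0

/-- The weak gradient `∇f` on `Ω`. -/
def weakGrad {m : ℕ} (Ω : Set (EuclideanSpace ℝ (Fin m)))
    (f : EuclideanSpace ℝ (Fin m) → ℝ) (x : EuclideanSpace ℝ (Fin m)) :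
    EuclideanSpace ℝ (Fin m) :=
  WithLp.toLp 2 fun i => weakPartial Ω i f x

/-- The weak divergence `∑_i ∂_i G_i` on `Ω` of a vector field `G`. -/
def weakDiv {m : ℕ} (Ω : Set (EuclideanSpace ℝ (Fin m)))
    (G : EuclideanSpace ℝ (Fin m) → EuclideanSpace ℝ (Fin m))
    (x : EuclideanSpace ℝ (Fin m)) : ℝ :=
  ∑ i, weakPartial Ω i (fun y => G y i) x

/-- The Sobolev space `W^{1,p}(Ω)` of real functions: `f ∈ L^p(Ω)` and every first-order weak
partial derivative exists and is in `L^p(Ω)`. -/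
structure MemW {m : ℕ} (Ω : Set (EuclideanSpace ℝ (Fin m))) (p : ℝ≥0∞)
    (f : EuclideanSpace ℝ (Fin m) → ℝ) : Prop where
  memLp : MemLp f p (volume.restrict Ω)
  exists_partial : ∀ i : Fin m, ∃ g : EuclideanSpace ℝ (Fin m) → ℝ,
    MemLp g p (volume.restrict Ω) ∧ HasWeakPartial Ω i f g

/-- The space `W_0^{1,p}(Ω)`: the closure in `W^{1,p}(Ω)` of the test functions on `Ω`. -/
structure MemWZero {m : ℕ} (Ω : Set (EuclideanSpace ℝ (Fin m))) (p : ℝ≥0∞)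
    (f : EuclideanSpace ℝ (Fin m) → ℝ) : Prop where
  memW : MemW Ω p f
  approx : ∀ ε : ℝ≥0∞, 0 < ε → ∃ φ : EuclideanSpace ℝ (Fin m) → ℝ, IsTest Ω φ ∧
    eLpNorm (fun x => f x - φ x) p (volume.restrict Ω) +
      ∑ i, eLpNorm (fun x => weakPartial Ω i f x - fderiv ℝ φ x (stdVec i)) p
        (volume.restrict Ω) < ε

/-- The functional `𝓕(u) = ∫_Ω (|∇u + F| + H u)`. -/
def functional {m : ℕ} (Ω : Set (EuclideanSpace ℝ (Fin m)))
    (F : EuclideanSpace ℝ (Fin m) → EuclideanSpace ℝ (Fin m))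
    (H : EuclideanSpace ℝ (Fin m) → ℝ) (u : EuclideanSpace ℝ (Fin m) → ℝ) : ℝ :=
  ∫ x in Ω, (‖weakGrad Ω u x + F x‖ + H x * u x)

/-- `u ∈ W^{1,1}(Ω)` is a minimizer: `𝓕(u) ≤ 𝓕(u + φ)` for all `φ ∈ W_0^{1,1}(Ω)`. -/
structure IsMinimizer {m : ℕ} (Ω : Set (EuclideanSpace ℝ (Fin m)))
    (F : EuclideanSpace ℝ (Fin m) → EuclideanSpace ℝ (Fin m))
    (H : EuclideanSpace ℝ (Fin m) → ℝ) (u : EuclideanSpace ℝ (Fin m) → ℝ) : Prop where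
  memW : MemW Ω 1 u
  le : ∀ φ : EuclideanSpace ℝ (Fin m) → ℝ, MemWZero Ω 1 φ →
    functional Ω F H u ≤ functional Ω F H (fun x => u x + φ x)

/-- `G* = (g_2, -g_1, g_4, -g_3, …, g_{2n}, -g_{2n-1})` for `G = (g_1, …, g_{2n})`. The indices
are shifted by one here: the coordinates are numbered from `0` to `2n - 1`. -/
def star {n : ℕ} (G : EuclideanSpace ℝ (Fin (2 * n))) : EuclideanSpace ℝ (Fin (2 * n)) :=
  WithLp.toLp 2 fun i =>
    if h : i.val % 2 = 0 then G ⟨i.val + 1, by omega⟩ else - G ⟨i.val - 1, by omega⟩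

end HeisenbergMin

end

/-! Write A = ∇u + F, B = ∇v + F and w = u - v. Comparing u and v with their midpoint forces
equality in |A + B| ≤ |A| + |B|, so A and B lie on a common ray a.e. (`IsMinimizer.sameRay`). Since
the star operation is linear and a* ⟂ a, it follows that A* ⟂ A - B = ∇w
(`sum_star_mul_sub_eq_zero`). Second derivatives commute, so (∇u)* is weakly divergence free and div
A* = div F* > 0 (`sum_integral_star_mul_fderiv`). Testing this identity formally with G(w), where G
≥ 0 vanishes only at 0, gives ∫ div F* · G(w) = -∫ G'(w) A*·∇w = 0, whence w = 0.
`MemWZero.ae_eq_zero_of_div_pos` makes this rigorous with G(t) = √(1 + t²) - 1. -/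

namespace HeisenbergMin

/-! ### Test functions and weak partial derivatives -/

variable {m : ℕ} {Ω : Set (EuclideanSpace ℝ (Fin m))} {i : Fin m} {p : ℝ≥0∞}
  {f g f' g' φ : EuclideanSpace ℝ (Fin m) → ℝ}

theorem IsTest.fderiv_apply (hφ : IsTest Ω φ) (v : EuclideanSpace ℝ (Fin m)) :
    IsTest Ω (fun x => fderiv ℝ φ x v) where
  smooth := (hφ.smooth.fderiv_right (m := ∞) (by simp)).clm_apply contDiff_const
  compact := hφ.compact.fderiv_apply ℝ v
  support := (tsupport_fderiv_apply_subset ℝ v).trans hφ.support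

theorem IsTest.const_mul (hφ : IsTest Ω φ) (c : ℝ) : IsTest Ω (fun x => c * φ x) where
  smooth := contDiff_const.mul hφ.smooth
  compact := hφ.compact.mul_left
  support := (tsupport_mul_subset_right (f := fun _ => c)).trans hφ.support

theorem IsTest.comp (hφ : IsTest Ω φ) {G : ℝ → ℝ} (hG : ContDiff ℝ ∞ G) (h0 : G 0 = 0) :
    IsTest Ω (fun x => G (φ x)) where
  smooth := hG.comp hφ.smooth
  compact := hφ.compact.comp_left h0
  support := (closure_mono (Function.support_comp_subset h0 φ)).trans hφ.support

theorem IsTest.memLp (hφ : IsTest Ω φ) : MemLp φ p (volume.restrict Ω) :=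
  (hφ.smooth.continuous.memLp_of_hasCompactSupport hφ.compact).restrict Ω

theorem IsTest.integrable_mul (hφ : IsTest Ω φ) (hf : LocallyIntegrableOn f Ω volume) :
    Integrable (fun x => f x * φ x) (volume.restrict Ω) := by
  have hK : IntegrableOn f (tsupport φ) volume :=
    hf.integrableOn_compact_subset hφ.support hφ.compact
  obtain ⟨C, hC⟩ := hφ.compact.exists_bound_of_continuous hφ.smooth.continuous
  have h1 : IntegrableOn (fun x => f x * φ x) (tsupport φ) volume :=
    Integrable.mul_bdd hK hφ.smooth.continuous.aestronglyMeasurable (.of_forall hC)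
  refine ((integrableOn_iff_integrable_of_support_subset ?_).1 h1).restrict
  exact (Function.support_mul_subset_right f φ).trans (subset_tsupport φ)

theorem HasWeakPartial.ae_eq (hΩ : IsOpen Ω) (h : HasWeakPartial Ω i f g)
    (h' : HasWeakPartial Ω i f g') : g =ᵐ[volume.restrict Ω] g' := by
  have key := hΩ.ae_eq_zero_of_integral_contDiff_smul_eq_zero (μ := volume)
    (h.locInt_deriv.sub h'.locInt_deriv) (by
      intro φ h1 h2 h3
      have hφ : IsTest Ω φ := ⟨h1, h2, h3⟩
      have e1 := h.integral_eq φ hφ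
      have e2 := h'.integral_eq φ hφ
      have e3 : ∫ x in Ω, (g x * φ x - g' x * φ x) = 0 := by
        rw [integral_sub (hφ.integrable_mul h.locInt_deriv) (hφ.integrable_mul h'.locInt_deriv)]
        linarith
      -- The fundamental lemma integrates over the whole space; φ vanishes off Ω.
      rw [← setIntegral_eq_integral_of_forall_compl_eq_zero (s := Ω), ← e3]
      · refine integral_congr_ae (.of_forall fun x => ?_)
        simp only [Pi.sub_apply, smul_eq_mul]
        ring
      · intro x hx
        rw [image_eq_zero_of_notMem_tsupport fun hx' => hx (h3 hx'), zero_smul])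
  rw [Filter.EventuallyEq, ae_restrict_iff' hΩ.measurableSet]
  filter_upwards [key] with x hx hxΩ
  exact sub_eq_zero.1 (hx hxΩ)

theorem HasWeakPartial.weakPartial (h : HasWeakPartial Ω i f g) :
    HasWeakPartial Ω i f (weakPartial Ω i f) := by
  have h' : ∃ g, HasWeakPartial Ω i f g := ⟨g, h⟩
  rw [HeisenbergMin.weakPartial, dif_pos h']
  exact h'.choose_spec

theorem HasWeakPartial.weakPartial_ae_eq (hΩ : IsOpen Ω) (h : HasWeakPartial Ω i f g) :
    HeisenbergMin.weakPartial Ω i f =ᵐ[volume.restrict Ω] g :=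
  h.weakPartial.ae_eq hΩ h

theorem HasWeakPartial.add (h : HasWeakPartial Ω i f g) (h' : HasWeakPartial Ω i f' g') :
    HasWeakPartial Ω i (fun x => f x + f' x) (fun x => g x + g' x) where
  locInt := h.locInt.add h'.locInt
  locInt_deriv := h.locInt_deriv.add h'.locInt_deriv
  integral_eq φ hφ := by
    have hd := hφ.fderiv_apply (stdVec i)
    simp only [add_mul]
    rw [integral_add (hd.integrable_mul h.locInt) (hd.integrable_mul h'.locInt),
      integral_add (hφ.integrable_mul h.locInt_deriv) (hφ.integrable_mul h'.locInt_deriv),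
      h.integral_eq φ hφ, h'.integral_eq φ hφ, neg_add]

theorem HasWeakPartial.const_mul (h : HasWeakPartial Ω i f g) (c : ℝ) :
    HasWeakPartial Ω i (fun x => c * f x) (fun x => c * g x) where
  locInt := h.locInt.smul c
  locInt_deriv := h.locInt_deriv.smul c
  integral_eq φ hφ := by
    simp only [mul_assoc, integral_const_mul]
    rw [h.integral_eq φ hφ, mul_neg]

/-! ### Sobolev spaces and approximation by test functions -/

theorem MemW.hasWeakPartial (hf : MemW Ω p f) (i : Fin m) :
    HasWeakPartial Ω i f (weakPartial Ω i f) := by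
  obtain ⟨g, -, hg⟩ := hf.exists_partial i
  exact hg.weakPartial

theorem MemW.memLp_weakPartial (hΩ : IsOpen Ω) (hf : MemW Ω p f) (i : Fin m) :
    MemLp (weakPartial Ω i f) p (volume.restrict Ω) := by
  obtain ⟨g, hg, hg'⟩ := hf.exists_partial i
  exact (memLp_congr_ae (hg'.weakPartial_ae_eq hΩ)).2 hg

theorem MemW.const_mul (hΩ : IsOpen Ω) (hf : MemW Ω p f) (c : ℝ) :
    MemW Ω p (fun x => c * f x) where
  memLp := hf.memLp.const_mul c
  exists_partial i := ⟨_, (hf.memLp_weakPartial hΩ i).const_mul c,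
    (hf.hasWeakPartial i).const_mul c⟩

theorem MemW.mono_exponent [IsFiniteMeasure (volume.restrict Ω)] {q : ℝ≥0∞} (hf : MemW Ω q f)
    (hpq : p ≤ q) : MemW Ω p f where
  memLp := hf.memLp.mono_exponent hpq
  exists_partial i := by
    obtain ⟨g, hg, hg'⟩ := hf.exists_partial i
    exact ⟨g, hg.mono_exponent hpq, hg'⟩

theorem MemWZero.const_mul (hΩ : IsOpen Ω) (hf : MemWZero Ω p f) (c : ℝ) :
    MemWZero Ω p (fun x => c * f x) where
  memW := hf.memW.const_mul hΩ c
  approx ε hε := by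
    have hc : ‖c‖ₑ + 1 ≠ ⊤ := by simp
    -- Dividing by ‖c‖ + 1 rather than ‖c‖ covers c = 0.
    obtain ⟨φ, hφ, h⟩ := hf.approx (ε / (‖c‖ₑ + 1)) (ENNReal.div_pos hε.ne' hc)
    refine ⟨_, hφ.const_mul c, ?_⟩
    have e0 : eLpNorm (fun x => c * f x - c * φ x) p (volume.restrict Ω)
        = ‖c‖ₑ * eLpNorm (fun x => f x - φ x) p (volume.restrict Ω) := by
      rw [← eLpNorm_const_smul]
      congr 1
      ext x
      simp [mul_sub]
    have e1 (i : Fin m) : eLpNorm (fun x => weakPartial Ω i (fun y => c * f y) x -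
          fderiv ℝ (fun y => c * φ y) x (stdVec i)) p (volume.restrict Ω)
        = ‖c‖ₑ * eLpNorm (fun x => weakPartial Ω i f x - fderiv ℝ φ x (stdVec i)) p
          (volume.restrict Ω) := by
      rw [← eLpNorm_const_smul]
      refine eLpNorm_congr_ae ?_
      filter_upwards [((hf.memW.hasWeakPartial i).const_mul c).weakPartial_ae_eq hΩ] with x hx
      rw [hx, fderiv_const_mul (hφ.smooth.differentiable (by simp) x)]
      simp [mul_sub]
    simp only [e0, e1, ← Finset.mul_sum, ← mul_add]
    calc _ ≤ (‖c‖ₑ + 1) * _ := mul_le_mul_left (self_le_add_right _ _) _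
      _ < ε := by
        rw [mul_comm]
        exact ENNReal.mul_lt_of_lt_div h

/-- Minimality is tested against W₀^{1,1}, while u - v is given in W₀^{1,2}; Hölder on a set of
finite measure bridges the two. -/
theorem MemWZero.mono_exponent [IsFiniteMeasure (volume.restrict Ω)] {q : ℝ≥0∞} (hΩ : IsOpen Ω)
    (hf : MemWZero Ω q f) (hp : p ≠ 0) (hpq : p ≤ q) : MemWZero Ω p f where
  memW := hf.memW.mono_exponent hpq
  approx ε hε := by
    set C : ℝ≥0∞ := volume.restrict Ω Set.univ ^ (1 / p.toReal - 1 / q.toReal) with hC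
    have hCtop : C ≠ ⊤ := by
      refine ENNReal.rpow_ne_top_of_nonneg ?_ (measure_ne_top _ _)
      -- Here `q.toReal = 0`, so `1 / q.toReal = 0` is the correct Hölder exponent.
      by_cases hq : q = ⊤
      · simp [hq]
      · have hp' : p ≠ ⊤ := ne_top_of_le_ne_top hq hpq
        rw [sub_nonneg]
        exact one_div_le_one_div_of_le (ENNReal.toReal_pos hp hp')
          (ENNReal.toReal_mono hq hpq)
    obtain ⟨φ, hφ, h⟩ := hf.approx (ε / (C + 1)) (ENNReal.div_pos hε.ne' (by simpa using hCtop))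
    refine ⟨φ, hφ, ?_⟩
    calc _ ≤ eLpNorm (fun x => f x - φ x) q (volume.restrict Ω) * C +
          ∑ i, eLpNorm (fun x => weakPartial Ω i f x - fderiv ℝ φ x (stdVec i)) q
            (volume.restrict Ω) * C := by
          refine add_le_add (eLpNorm_le_eLpNorm_mul_rpow_measure_univ hpq
            (hf.memW.memLp.1.sub hφ.smooth.continuous.aestronglyMeasurable))
            (Finset.sum_le_sum fun i _ => eLpNorm_le_eLpNorm_mul_rpow_measure_univ hpq
              ((hf.memW.memLp_weakPartial hΩ i).1.sub
                (hφ.fderiv_apply _).smooth.continuous.aestronglyMeasurable))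
      _ = _ * C := by rw [← Finset.sum_mul, ← add_mul]
      _ ≤ _ * (C + 1) := mul_le_mul_right (self_le_add_right _ _) _
      _ < ε := ENNReal.mul_lt_of_lt_div h

theorem MemWZero.exists_tendsto (hf : MemWZero Ω p f) :
    ∃ φ : ℕ → EuclideanSpace ℝ (Fin m) → ℝ, (∀ k, IsTest Ω (φ k)) ∧
      Tendsto (fun k => eLpNorm (fun x => f x - φ k x) p (volume.restrict Ω)) atTop (𝓝 0) ∧
      ∀ i, Tendsto (fun k => eLpNorm
        (fun x => weakPartial Ω i f x - fderiv ℝ (φ k) x (stdVec i)) p (volume.restrict Ω))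
        atTop (𝓝 0) := by
  choose φ hφ h using fun k : ℕ => hf.approx ((k : ℝ≥0∞)⁻¹) (by simp)
  have hlim := ENNReal.tendsto_inv_nat_nhds_zero
  refine ⟨φ, hφ, ?_, fun i => ?_⟩
  · exact tendsto_of_tendsto_of_tendsto_of_le_of_le tendsto_const_nhds hlim
      (fun _ => zero_le) fun k => (self_le_add_right _ _).trans (h k).le
  · refine tendsto_of_tendsto_of_tendsto_of_le_of_le tendsto_const_nhds hlim
      (fun _ => zero_le) fun k => le_trans ?_ ((self_le_add_left _ _).trans (h k).le)
    exact Finset.single_le_sum (f := fun i => eLpNorm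
      (fun x => weakPartial Ω i f x - fderiv ℝ (φ k) x (stdVec i)) p (volume.restrict Ω))
      (fun _ _ => zero_le) (Finset.mem_univ i)

/-- Pairing with a fixed `L²` function is continuous at `0` along `L²` convergence. -/
theorem tendsto_integral_mul_zero {α : Type*} [MeasurableSpace α] {μ : Measure α} {h : α → ℝ}
    (hh : MemLp h 2 μ) {e : ℕ → α → ℝ} (he : ∀ k, AEStronglyMeasurable (e k) μ)
    (hlim : Tendsto (fun k => eLpNorm (e k) 2 μ) atTop (𝓝 0)) :
    Tendsto (fun k => ∫ x, h x * e k x ∂μ) atTop (𝓝 0) := by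
  have h1 : Tendsto (fun k => ∫⁻ x, ‖h x * e k x‖ₑ ∂μ) atTop (𝓝 0) := by
    have h2 : Tendsto (fun k => eLpNorm h 2 μ * eLpNorm (e k) 2 μ) atTop (𝓝 0) := by
      simpa using ENNReal.Tendsto.const_mul hlim (Or.inr hh.eLpNorm_ne_top)
    refine tendsto_of_tendsto_of_tendsto_of_le_of_le tendsto_const_nhds h2
      (fun _ => zero_le) fun k => ?_
    have h3 := eLpNorm_smul_le_mul_eLpNorm (p := 2) (q := 2) (r := 1) (he k) hh.1
    rwa [eLpNorm_one_eq_lintegral_enorm] at h3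
  refine squeeze_zero_norm (a := fun k => (∫⁻ x, ‖h x * e k x‖ₑ ∂μ).toReal) (fun k => ?_)
    ((ENNReal.tendsto_toReal ENNReal.zero_ne_top).comp h1)
  rw [← integral_norm_eq_lintegral_enorm (f := fun x => h x * e k x) (hh.1.mul (he k))]
  exact norm_integral_le_integral_norm _

/-! ### Convexity of the functional and pairs of minimizers -/

section Functional

variable {F : EuclideanSpace ℝ (Fin m) → EuclideanSpace ℝ (Fin m)}
  {H u v : EuclideanSpace ℝ (Fin m) → ℝ}

theorem weakGrad_midpoint (hΩ : IsOpen Ω) (hu : MemW Ω p u) (hv : MemW Ω p v) :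
    weakGrad Ω (fun x => u x + -(1 / 2) * (u x - v x)) =ᵐ[volume.restrict Ω]
      fun x => (1 / 2 : ℝ) • (weakGrad Ω u x + weakGrad Ω v x) := by
  have h : ∀ᵐ x ∂(volume.restrict Ω), ∀ i : Fin m,
      weakPartial Ω i (fun x => 1 / 2 * u x + 1 / 2 * v x) x
        = 1 / 2 * weakPartial Ω i u x + 1 / 2 * weakPartial Ω i v x :=
    ae_all_iff.2 fun i => (((hu.hasWeakPartial i).const_mul (1 / 2)).add
      ((hv.hasWeakPartial i).const_mul (1 / 2))).weakPartial_ae_eq hΩ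
  have e : (fun x => u x + -(1 / 2) * (u x - v x)) = fun x => 1 / 2 * u x + 1 / 2 * v x := by
    ext x
    ring
  rw [e]
  filter_upwards [h] with x hx
  ext i
  simp only [weakGrad, hx, PiLp.smul_apply, PiLp.add_apply, smul_eq_mul]
  ring

theorem memLp_weakGrad_add (hΩ : IsOpen Ω) (hF : ∀ i, MemW Ω p (fun x => F x i))
    (hu : MemW Ω p u) : MemLp (fun x => weakGrad Ω u x + F x) p (volume.restrict Ω) := by
  refine MemLp.of_eval_piLp fun i => ?_
  exact (hu.memLp_weakPartial hΩ i).add (hF i).memLp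

/-- With mid = (u + v)/2, the terms in H cancel in 𝓕(u) + 𝓕(v) - 2𝓕(mid), which equals the integral
of the nonnegative gap |A| + |B| - |A + B|. Minimality makes it ≤ 0, so the gap vanishes a.e.;
strict convexity of the Euclidean norm then gives the common ray. -/
theorem IsMinimizer.sameRay (hΩ : IsOpen Ω) (hH : MemLp H ⊤ (volume.restrict Ω))
    (hF : ∀ i, MemW Ω 1 (fun x => F x i)) (hu : IsMinimizer Ω F H u) (hv : IsMinimizer Ω F H v)
    (huv : MemWZero Ω 1 (fun x => u x - v x)) :
    ∀ᵐ x ∂(volume.restrict Ω), SameRay ℝ (weakGrad Ω u x + F x) (weakGrad Ω v x + F x) := by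
  have hA := memLp_one_iff_integrable.1 (memLp_weakGrad_add hΩ hF hu.memW)
  have hB := memLp_one_iff_integrable.1 (memLp_weakGrad_add hΩ hF hv.memW)
  have hHu : Integrable (fun x => H x * u x) (volume.restrict Ω) :=
    memLp_one_iff_integrable.1 (hu.memW.memLp.mul hH)
  have hHv : Integrable (fun x => H x * v x) (volume.restrict Ω) :=
    memLp_one_iff_integrable.1 (hv.memW.memLp.mul hH)
  -- The competitor u - (u - v)/2 is the midpoint.
  have h1 := hu.le _ (huv.const_mul hΩ (-(1 / 2)))
  have h2 : functional Ω F H v ≤ functional Ω F H u := by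
    have h := hv.le _ (huv.const_mul hΩ 1)
    simpa using h
  have hmid : functional Ω F H (fun x => u x + -(1 / 2) * (u x - v x)) =
      ∫ x in Ω, (1 / 2 * ‖(weakGrad Ω u x + F x) + (weakGrad Ω v x + F x)‖ +
        1 / 2 * (H x * u x + H x * v x)) := by
    refine integral_congr_ae ?_
    filter_upwards [weakGrad_midpoint hΩ hu.memW hv.memW] with x hx
    have e : weakGrad Ω (fun x => u x + -(1 / 2) * (u x - v x)) x + F x =
        (1 / 2 : ℝ) • ((weakGrad Ω u x + F x) + (weakGrad Ω v x + F x)) := by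
      rw [hx]
      module
    rw [e, norm_smul, Real.norm_of_nonneg (by norm_num : (0 : ℝ) ≤ 1 / 2)]
    ring
  have hgap : ∫ x in Ω, (‖weakGrad Ω u x + F x‖ + ‖weakGrad Ω v x + F x‖ -
      ‖(weakGrad Ω u x + F x) + (weakGrad Ω v x + F x)‖) ≤ 0 := by
    have hAB : Integrable (fun x => ‖(weakGrad Ω u x + F x) + (weakGrad Ω v x + F x)‖)
        (volume.restrict Ω) := (hA.add hB).norm
    have hHuv : Integrable (fun x => H x * u x + H x * v x) (volume.restrict Ω) := hHu.add hHv
    rw [hmid, integral_add (hAB.const_mul _) (hHuv.const_mul _),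
      integral_const_mul, integral_const_mul, integral_add hHu hHv] at h1
    unfold functional at h1 h2
    rw [integral_add hA.norm hHu] at h1 h2
    rw [integral_add hB.norm hHv] at h2
    rw [integral_sub (f := fun x => ‖weakGrad Ω u x + F x‖ + ‖weakGrad Ω v x + F x‖)
      (hA.norm.add hB.norm) hAB, integral_add hA.norm hB.norm]
    linarith
  have hnonneg : ∀ x, 0 ≤ ‖weakGrad Ω u x + F x‖ + ‖weakGrad Ω v x + F x‖ -
      ‖(weakGrad Ω u x + F x) + (weakGrad Ω v x + F x)‖ := fun x =>
    sub_nonneg.2 (norm_add_le _ _)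
  have hzero := (integral_eq_zero_iff_of_nonneg hnonneg
    ((hA.norm.add hB.norm).sub (hA.add hB).norm)).1
    (le_antisymm hgap (integral_nonneg hnonneg))
  filter_upwards [hzero] with x hx
  exact sameRay_iff_norm_add.2 (sub_eq_zero.1 hx).symm

end Functional

/-! ### Algebra of the star operation and its divergence -/

section Star

variable {n : ℕ}

/-- The involution of the indices underlying `star`. -/
def partner (i : Fin (2 * n)) : Fin (2 * n) :=
  if h : i.val % 2 = 0 then ⟨i.val + 1, by omega⟩ else ⟨i.val - 1, by omega⟩

/-- The sign of the `i`-th coordinate in `star`. -/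
def starSign (i : Fin (2 * n)) : ℝ :=
  if i.val % 2 = 0 then 1 else -1

theorem star_apply (G : EuclideanSpace ℝ (Fin (2 * n))) (i : Fin (2 * n)) :
    star G i = starSign i * G (partner i) := by
  by_cases h : i.val % 2 = 0 <;> simp [star, starSign, partner, h]

theorem partner_involutive : Function.Involutive (partner (n := n)) := by
  intro i
  by_cases h : i.val % 2 = 0
  · have : (i.val + 1) % 2 ≠ 0 := by omega
    simp [partner, h, this]
  · have : (i.val - 1) % 2 = 0 := by omega
    ext
    simp only [partner, h, this, dite_false, dite_true]
    omega

theorem starSign_partner (i : Fin (2 * n)) : starSign (partner i) = -starSign i := by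
  by_cases h : i.val % 2 = 0
  · have : (i.val + 1) % 2 ≠ 0 := by omega
    simp [starSign, partner, h, this]
  · have : (i.val - 1) % 2 = 0 := by omega
    simp [starSign, partner, h, this]

/-- Reindexing by `partner` flips the sign and transposes M, so the sum equals its own negative.
This serves both for w* ⟂ w (M = w ⊗ w, up to a scalar) and for div (∇u)* = 0 (M built from the
Hessian of φ). -/
theorem sum_starSign_mul_eq_zero {M : Fin (2 * n) → Fin (2 * n) → ℝ}
    (hM : ∀ i j, M i j = M j i) : ∑ i, starSign i * M (partner i) i = 0 := by
  have h := Equiv.sum_comp (partner_involutive (n := n)).toPerm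
    (fun i => starSign i * M (partner i) i)
  simp only [Function.Involutive.coe_toPerm, starSign_partner, partner_involutive _] at h
  have h' : ∑ i : Fin (2 * n), -starSign i * M i (partner i)
      = -∑ i, starSign i * M (partner i) i := by
    rw [← Finset.sum_neg_distrib]
    exact Finset.sum_congr rfl fun i _ => by rw [hM, neg_mul]
  linarith

theorem sum_star_mul_sub_eq_zero {a b : EuclideanSpace ℝ (Fin (2 * n))} (h : SameRay ℝ a b) :
    ∑ i, star a i * (a i - b i) = 0 := by
  -- With a = r w and b = s w, the sum is r (r - s) w*·w.
  obtain ⟨w, r, s, -, -, -, rfl, rfl⟩ := h.exists_eq_smul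
  rw [← sum_starSign_mul_eq_zero (M := fun i j => r * (r - s) * (w i * w j))
    fun i j => by ring]
  refine Finset.sum_congr rfl fun i _ => ?_
  simp only [star_apply, PiLp.smul_apply, smul_eq_mul]
  ring

variable {Ω : Set (EuclideanSpace ℝ (Fin (2 * n)))} {u φ : EuclideanSpace ℝ (Fin (2 * n)) → ℝ}
  {F : EuclideanSpace ℝ (Fin (2 * n)) → EuclideanSpace ℝ (Fin (2 * n))}

theorem MemW.star_apply (hΩ : IsOpen Ω) (hF : ∀ i, MemW Ω p (fun x => F x i))
    (i : Fin (2 * n)) : MemW Ω p (fun x => star (F x) i) := by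
  simp only [HeisenbergMin.star_apply]
  exact (hF _).const_mul hΩ _

theorem memLp_weakDiv {m : ℕ} {Ω : Set (EuclideanSpace ℝ (Fin m))} (hΩ : IsOpen Ω)
    {G : EuclideanSpace ℝ (Fin m) → EuclideanSpace ℝ (Fin m)}
    (hG : ∀ i, MemW Ω p (fun x => G x i)) :
    MemLp (weakDiv Ω G) p (volume.restrict Ω) :=
  memLp_finsetSum Finset.univ fun i _ => (hG i).memLp_weakPartial hΩ i

theorem integral_mul_fderiv_eq_neg_weakDiv {m : ℕ} {Ω : Set (EuclideanSpace ℝ (Fin m))}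
    {φ : EuclideanSpace ℝ (Fin m) → ℝ} {G : EuclideanSpace ℝ (Fin m) → EuclideanSpace ℝ (Fin m)}
    (hG : ∀ i, MemW Ω p (fun x => G x i)) (hφ : IsTest Ω φ) :
    ∑ i, ∫ x in Ω, G x i * fderiv ℝ φ x (stdVec i) = -∫ x in Ω, weakDiv Ω G x * φ x := by
  have h (i : Fin m) := (hG i).hasWeakPartial i
  simp only [weakDiv, Finset.sum_mul]
  rw [integral_finsetSum _ fun i _ => hφ.integrable_mul (h i).locInt_deriv,
    ← Finset.sum_neg_distrib]
  exact Finset.sum_congr rfl fun i _ => (h i).integral_eq φ hφ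

theorem fderiv_fderiv_comm {m : ℕ} {φ : EuclideanSpace ℝ (Fin m) → ℝ} (hφ : ContDiff ℝ ∞ φ)
    (x v w : EuclideanSpace ℝ (Fin m)) :
    fderiv ℝ (fun y => fderiv ℝ φ y v) x w = fderiv ℝ (fun y => fderiv ℝ φ y w) x v := by
  have hd : DifferentiableAt ℝ (fderiv ℝ φ) x :=
    (hφ.fderiv_right (m := ∞) (by simp)).differentiable (by simp) x
  have hs : IsSymmSndFDerivAt ℝ φ x := hφ.contDiffAt.isSymmSndFDerivAt (by
    simpa using WithTop.coe_le_coe.2 (le_top : (2 : ℕ∞) ≤ ⊤))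
  rw [fderiv_clm_apply hd (differentiableAt_const v), fderiv_clm_apply hd (differentiableAt_const w)]
  simpa using hs w v

/-- The field `(∇u)*` is weakly divergence free. -/
theorem sum_integral_star_weakGrad_mul_fderiv (hu : MemW Ω p u) (hφ : IsTest Ω φ) :
    ∑ i, ∫ x in Ω, star (weakGrad Ω u x) i * fderiv ℝ φ x (stdVec i) = 0 := by
  have h (i : Fin (2 * n)) : ∫ x in Ω, star (weakGrad Ω u x) i * fderiv ℝ φ x (stdVec i) =
      starSign i * -∫ x in Ω, u x * fderiv ℝ (fun y => fderiv ℝ φ y (stdVec i)) x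
        (stdVec (partner i)) := by
    rw [(hu.hasWeakPartial (partner i)).integral_eq _ (hφ.fderiv_apply (stdVec i)), neg_neg,
      ← integral_const_mul]
    simp only [star_apply, weakGrad, mul_assoc]
  simp only [h]
  refine sum_starSign_mul_eq_zero (M := fun j i => -∫ x in Ω, u x *
    fderiv ℝ (fun y => fderiv ℝ φ y (stdVec i)) x (stdVec j)) fun i j => ?_
  simp only [fderiv_fderiv_comm hφ.smooth _ (stdVec j)]

theorem sum_integral_star_mul_fderiv (hΩ : IsOpen Ω) (hF : ∀ i, MemW Ω p (fun x => F x i))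
    (hu : MemW Ω p u) (hφ : IsTest Ω φ) :
    ∑ i, ∫ x in Ω, star (weakGrad Ω u x + F x) i * fderiv ℝ φ x (stdVec i)
      = -∫ x in Ω, weakDiv Ω (fun y => star (F y)) x * φ x := by
  have hG := MemW.star_apply hΩ hF
  rw [← integral_mul_fderiv_eq_neg_weakDiv hG hφ,
    ← zero_add (∑ i, ∫ x in Ω, star (F x) i * _),
    ← sum_integral_star_weakGrad_mul_fderiv hu hφ, ← Finset.sum_add_distrib]
  refine Finset.sum_congr rfl fun i _ => ?_
  have hd := hφ.fderiv_apply (stdVec i)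
  have h1 : LocallyIntegrableOn (fun x => star (weakGrad Ω u x) i) Ω volume := by
    simp only [star_apply]
    exact (hu.hasWeakPartial (partner i)).locInt_deriv.smul (starSign i)
  rw [← integral_add (hd.integrable_mul h1) (hd.integrable_mul (hG i |>.hasWeakPartial i).locInt)]
  refine integral_congr_ae (.of_forall fun x => ?_)
  simp only [star_apply, PiLp.add_apply]
  ring

end Star

/-! ### A smooth 1-Lipschitz substitute for the square -/

section Truncation

theorem contDiff_sqrt_one_add_sq_sub_one : ContDiff ℝ ∞ fun t : ℝ => √(1 + t ^ 2) - 1 :=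
  ((contDiff_const.add (contDiff_id.pow 2)).sqrt fun t => by positivity).sub contDiff_const

theorem abs_deriv_sqrt_one_add_sq_sub_one_le (t : ℝ) :
    |deriv (fun t : ℝ => √(1 + t ^ 2) - 1) t| ≤ 1 := by
  have h : HasDerivAt (fun t : ℝ => √(1 + t ^ 2) - 1) (2 * t / (2 * √(1 + t ^ 2))) t := by
    have h1 : HasDerivAt (fun t : ℝ => 1 + t ^ 2) (2 * t) t := by
      simpa using (hasDerivAt_pow 2 t).const_add 1
    exact (h1.sqrt (by positivity)).sub_const 1
  rw [h.deriv, mul_div_mul_left _ _ two_ne_zero, abs_div, abs_of_nonneg (Real.sqrt_nonneg _)]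
  exact div_le_one_of_le₀ (Real.abs_le_sqrt (by linarith)) (Real.sqrt_nonneg _)

theorem abs_sqrt_one_add_sq_sub_one_sub_le (s t : ℝ) :
    |(√(1 + s ^ 2) - 1) - (√(1 + t ^ 2) - 1)| ≤ |s - t| := by
  have h := lipschitzWith_of_nnnorm_deriv_le (C := 1)
    (contDiff_sqrt_one_add_sq_sub_one.differentiable (by simp))
    (fun t => abs_deriv_sqrt_one_add_sq_sub_one_le t)
  simpa [Real.dist_eq] using h.dist_le_mul s t

end Truncation

/-! ### Vanishing of w and the uniqueness theorem -/

theorem integrable_mul_of_memLp_two {α : Type*} [MeasurableSpace α] {μ : Measure α}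
    {f g : α → ℝ} (hf : MemLp f 2 μ) (hg : MemLp g 2 μ) : Integrable (fun x => f x * g x) μ :=
  hf.integrable_mul hg

/-- If `A` is an `L²` field orthogonal to `∇w` whose weak divergence is positive, then
`w ∈ W_0^{1,2}` vanishes. -/
theorem MemWZero.ae_eq_zero_of_div_pos (hΩ : IsOpen Ω) {w D : EuclideanSpace ℝ (Fin m) → ℝ}
    {A : Fin m → EuclideanSpace ℝ (Fin m) → ℝ} (hw : MemWZero Ω 2 w)
    (hA : ∀ i, MemLp (A i) 2 (volume.restrict Ω)) (hD : MemLp D 2 (volume.restrict Ω))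
    (hDpos : ∀ᵐ x ∂(volume.restrict Ω), 0 < D x)
    (hdiv : ∀ φ, IsTest Ω φ →
      ∑ i, ∫ x in Ω, A i x * fderiv ℝ φ x (stdVec i) = -∫ x in Ω, D x * φ x)
    (horth : ∀ᵐ x ∂(volume.restrict Ω), ∑ i, A i x * weakPartial Ω i w x = 0) :
    w =ᵐ[volume.restrict Ω] 0 := by
  -- G is applied to the smooth approximants φ k, so no chain rule for w is needed; |G'| ≤ 1 keeps
  -- every error controlled in L².
  obtain ⟨φ, hφ, hlim, hlim'⟩ := hw.exists_tendsto
  set G : ℝ → ℝ := fun t => √(1 + t ^ 2) - 1 with hGdef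
  have hG : ContDiff ℝ ∞ G := contDiff_sqrt_one_add_sq_sub_one
  have hG' : Continuous (deriv G) := hG.continuous_deriv (by simp)
  have hG1 (t : ℝ) : |deriv G t| ≤ 1 := abs_deriv_sqrt_one_add_sq_sub_one_le t
  have hG2 (s t : ℝ) : |G s - G t| ≤ |s - t| := abs_sqrt_one_add_sq_sub_one_sub_le s t
  have hG0 : G 0 = 0 := by simp [hGdef]
  have htest (k : ℕ) : IsTest Ω (fun x => G (φ k x)) := (hφ k).comp hG hG0
  have hmφ (k : ℕ) : AEStronglyMeasurable (φ k) (volume.restrict Ω) :=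
    (hφ k).smooth.continuous.aestronglyMeasurable
  have hGw : MemLp (fun x => G (w x)) 2 (volume.restrict Ω) :=
    hw.memW.memLp.of_le (hG.continuous.comp_aestronglyMeasurable hw.memW.memLp.1)
      (.of_forall fun x => by simpa [hG0] using hG2 (w x) 0)
  have e1 : Tendsto (fun k => ∫ x in Ω, D x * (G (w x) - G (φ k x))) atTop (𝓝 0) := by
    refine tendsto_integral_mul_zero hD
      (fun k => hGw.1.sub (hG.continuous.comp_aestronglyMeasurable (hmφ k))) ?_
    exact tendsto_of_tendsto_of_tendsto_of_le_of_le tendsto_const_nhds hlim (fun _ => zero_le)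
      fun k => eLpNorm_mono fun x => hG2 _ _
  have hpart (i : Fin m) (k : ℕ) : MemLp
      (fun x => deriv G (φ k x) * (weakPartial Ω i w x - fderiv ℝ (φ k) x (stdVec i))) 2
      (volume.restrict Ω) := by
    refine ((hw.memW.memLp_weakPartial hΩ i).sub ((hφ k).fderiv_apply (stdVec i)).memLp).of_le
      ((hG'.comp_aestronglyMeasurable (hmφ k)).mul
        ((hw.memW.memLp_weakPartial hΩ i).1.sub
          ((hφ k).fderiv_apply (stdVec i)).smooth.continuous.aestronglyMeasurable))
      (.of_forall fun x => ?_)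
    rw [norm_mul]
    exact mul_le_of_le_one_left (norm_nonneg _) (hG1 _)
  have e2 (i : Fin m) : Tendsto (fun k => ∫ x in Ω, A i x *
      (deriv G (φ k x) * (weakPartial Ω i w x - fderiv ℝ (φ k) x (stdVec i)))) atTop (𝓝 0) := by
    refine tendsto_integral_mul_zero (hA i) (fun k => (hpart i k).1) ?_
    refine tendsto_of_tendsto_of_tendsto_of_le_of_le tendsto_const_nhds (hlim' i)
      (fun _ => zero_le) fun k => eLpNorm_mono fun x => ?_
    rw [norm_mul]
    exact mul_le_of_le_one_left (norm_nonneg _) (hG1 _)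
  -- Orthogonality removes the ∇w term, leaving -∑ A i G'(φ k) ∂_i φ k; by the chain rule this is
  -- the divergence identity tested with G(φ k).
  have e3 (k : ℕ) : ∑ i, ∫ x in Ω, A i x *
      (deriv G (φ k x) * (weakPartial Ω i w x - fderiv ℝ (φ k) x (stdVec i)))
      = ∫ x in Ω, D x * G (φ k x) := by
    have hd (i : Fin m) := (htest k).fderiv_apply (stdVec i)
    rw [← neg_neg (∫ x in Ω, D x * G (φ k x)), ← hdiv _ (htest k),
      ← integral_finsetSum _ fun i _ => integrable_mul_of_memLp_two (hA i) (hpart i k),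
      ← integral_finsetSum _
        fun i _ => integrable_mul_of_memLp_two (hA i) (hd i).memLp, ← integral_neg]
    refine integral_congr_ae ?_
    filter_upwards [horth] with x hx
    have hc (i : Fin m) : fderiv ℝ (fun y => G (φ k y)) x (stdVec i)
        = deriv G (φ k x) * fderiv ℝ (φ k) x (stdVec i) := by
      have := ((hG.differentiable (by simp) (φ k x)).hasDerivAt.comp_hasFDerivAt x
        ((hφ k).smooth.differentiable (by simp) x).hasFDerivAt).fderiv
      rw [Function.comp_def] at this
      rw [this]
      simp
    calc _ = deriv G (φ k x) * ∑ i, A i x * weakPartial Ω i w x -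
          ∑ i, A i x * (deriv G (φ k x) * fderiv ℝ (φ k) x (stdVec i)) := by
          rw [Finset.mul_sum, ← Finset.sum_sub_distrib]
          exact Finset.sum_congr rfl fun i _ => by ring
      _ = _ := by simp only [hx, hc, mul_zero, zero_sub]
  -- By `e3`, the sequences in `e1` and `e2` add up to the constant ∫ D G(w), while their limits are
  -- 0.
  have e4 : ∫ x in Ω, D x * G (w x) = 0 := by
    have h := e1.add (tendsto_finsetSum Finset.univ fun i _ => e2 i)
    refine tendsto_nhds_unique (tendsto_const_nhds.congr fun k => ?_) (by simpa using h)
    rw [e3, ← integral_add (f := fun x => D x * (G (w x) - G (φ k x)))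
      (integrable_mul_of_memLp_two hD (hGw.sub (htest k).memLp))
      (integrable_mul_of_memLp_two hD (htest k).memLp)]
    exact integral_congr_ae (.of_forall fun x => by simp only; ring)
  have hGnonneg (t : ℝ) : 0 ≤ G t :=
    sub_nonneg.2 (Real.one_le_sqrt.2 (by nlinarith [sq_nonneg t]))
  have e5 := (integral_eq_zero_iff_of_nonneg_ae
    (hDpos.mono fun x hx => mul_nonneg hx.le (hGnonneg (w x)))
    (hD.integrable_mul hGw)).1 e4
  filter_upwards [e5, hDpos] with x hx hpos
  have h0 : G (w x) = 0 := (mul_eq_zero.1 hx).resolve_left hpos.ne'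
  have h1 : √(1 + w x ^ 2) = 1 := sub_eq_zero.1 h0
  rw [Real.sqrt_eq_one] at h1
  simpa using h1

end HeisenbergMin

theorem theoremB (n : ℕ)
    (Ω : Set (EuclideanSpace ℝ (Fin (2 * n)))) (hΩ : IsOpen Ω) (hΩb : Bornology.IsBounded Ω)
    (H : EuclideanSpace ℝ (Fin (2 * n)) → ℝ) (hH : MemLp H ∞ (volume.restrict Ω))
    (F : EuclideanSpace ℝ (Fin (2 * n)) → EuclideanSpace ℝ (Fin (2 * n)))
    (hF : ∀ i, HeisenbergMin.MemW Ω 2 (fun x => F x i))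
    (hdiv : ∀ᵐ x ∂(volume.restrict Ω),
      0 < HeisenbergMin.weakDiv Ω (fun y => HeisenbergMin.star (F y)) x)
    (u v : EuclideanSpace ℝ (Fin (2 * n)) → ℝ)
    (hu : HeisenbergMin.MemW Ω 2 u) (hv : HeisenbergMin.MemW Ω 2 v)
    (hu_min : HeisenbergMin.IsMinimizer Ω F H u) (hv_min : HeisenbergMin.IsMinimizer Ω F H v)
    (huv : HeisenbergMin.MemWZero Ω 2 (fun x => u x - v x)) :
    u =ᵐ[volume.restrict Ω] v := by
  have : IsFiniteMeasure (volume.restrict Ω) :=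
    ⟨by simpa using hΩb.measure_lt_top⟩
  have hray := hu_min.sameRay hΩ hH (fun i => (hF i).mono_exponent one_le_two) hv_min
    (huv.mono_exponent hΩ one_ne_zero one_le_two)
  have hgrad : ∀ᵐ x ∂(volume.restrict Ω), ∀ i, HeisenbergMin.weakPartial Ω i (fun y => u y - v y) x
      = HeisenbergMin.weakPartial Ω i u x - HeisenbergMin.weakPartial Ω i v x := by
    refine ae_all_iff.2 fun i => ?_
    have h := (hu.hasWeakPartial i).add ((hv.hasWeakPartial i).const_mul (-1))
    simp only [neg_one_mul, ← sub_eq_add_neg] at h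
    exact h.weakPartial_ae_eq hΩ
  have hw := huv.ae_eq_zero_of_div_pos hΩ
    (A := fun i x => HeisenbergMin.star (HeisenbergMin.weakGrad Ω u x + F x) i)
    (fun i => by
      simp only [HeisenbergMin.star_apply]
      exact (((hu.memLp_weakPartial hΩ _).add (hF _).memLp).const_mul _))
    (HeisenbergMin.memLp_weakDiv hΩ (HeisenbergMin.MemW.star_apply hΩ hF)) hdiv
    (fun φ hφ => HeisenbergMin.sum_integral_star_mul_fderiv hΩ hF hu hφ) (by
      filter_upwards [hray, hgrad] with x hx hg
      rw [← HeisenbergMin.sum_star_mul_sub_eq_zero hx]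
      refine Finset.sum_congr rfl fun i _ => ?_
      rw [hg]
      simp [HeisenbergMin.weakGrad])
  filter_upwards [hw] with x hx
  exact sub_eq_zero.1 hx
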